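/- For an infinite cardinal $\kappa$ let $\lambda_\kappa$ be the standard product (Haar probability) measure on the Borel sets of $\{0,1\}^\kappa$, let $\mathbb{M}_\kappa=\mathrm{Bor}(\{0,1\}^\kappa)/\{\lambda_\kappa=0\}$, and let $\mathbb{M}=\mathbb{M}_\omega$. A finitely additive measure $\mu$ on a Boolean algebra $\mathbb{A}$ is called separable if the pseudometric $d_\mu(A,B)=\mu(A\triangle B)$ on $\mathbb{A}$ is separable. For a Boolean homomorphism $\varphi:\mathbb{A}\to\mathbb{M}_\kappa$ let $\dot\varphi=\{\langle \check A,\varphi(A)\rangle : A\in\mathbb{A}\}$ be the associated $\mathbb{M}_\kappa$-name for an ultrafilter on $\mathbb{A}$. **Theorem.** Let $\kappa$ be an infinite cardinal, let $\mathbb{A}$ be a Boolean algebra, and let $\varphi:\mathbb{A}\to\mathbb{M}_\kappa$ be a Boolean homomorphism such that the measure $\lambda_\kappa\circ\varphi$ on $\mathbb{A}$ is separable. Then there is a Boolean subalgebra $\mathbb{M}'\subseteq\mathbb{M}_\kappa$, isomorphic to $\mathbb{M}$ and regular in $\mathbb{M}_\kappa$ (suprema existing in $\mathbb{M}'$ are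 suprema in $\mathbb{M}_\kappa$, so that a generic filter on $\mathbb{M}_\kappa$ traces a generic filter on $\mathbb{M}'$), such that $\varphi[\mathbb{A}]\subseteq\mathbb{M}'$. In particular $\dot\varphi$ is an $\mathbb{M}'$-name, and so it can be added by forcing with $\mathbb{M}$ (that is, by a single random real): if $f:\mathbb{M}\to\mathbb{M}'$ is a suitable isomorphism, there is an $\mathbb{M}$-name $\sigma$ such that $1\Vdash_{\mathbb{M}}$ "$\sigma$ is an ultrafilter on $\mathbb{A}$" and $1\Vdash_{\mathbb{M}_\kappa} f_*(\sigma)=\dot\varphi$, where $f_*(\sigma)$ is the $\mathbb{M}_\kappa$-name obtained from $\sigma$ by applying $f$ hereditarily. -/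

import Mathlib

universe u v w

open MeasureTheory
open scoped symmDiff

/-! ### The measure algebra of a measure -/

/-- Equality almost everywhere of measurable sets. -/
def nullSetoid {X : Type u} [MeasurableSpace X] (m : Measure X) :
    Setoid (Subtype (MeasurableSet : Set X → Prop)) where
  r s t := (s : Set X) =ᵐ[m] (t : Set X)
  iseqv := ⟨fun _ => Filter.EventuallyEq.rfl, fun h => h.symm, fun h h' => h.trans h'⟩

/-- The quotient of the σ-algebra of measurable sets by the ideal of null sets. -/
def MeasureAlgebra {X : Type u} [MeasurableSpace X] (m : Measure X) : Type u :=
  Quotient (nullSetoid m)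

namespace MeasureAlgebra

variable {X : Type u} [MeasurableSpace X] {m : Measure X}

/-- The class of a measurable set. -/
def mk (m : Measure X) (s : Subtype (MeasurableSet : Set X → Prop)) : MeasureAlgebra m :=
  Quotient.mk (nullSetoid m) s

/-- The Boolean operations are those of the σ-algebra, applied to representatives. -/
instance : BooleanAlgebra (MeasureAlgebra m) where
  sup := Quotient.map₂ (· ⊔ ·) fun _ _ h _ _ h' => ae_eq_set_union h h'
  inf := Quotient.map₂ (· ⊓ ·) fun _ _ h _ _ h' => ae_eq_set_inter h h'
  compl := Quotient.map (fun s => sᶜ) fun _ _ h => Filter.EventuallyEq.compl h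
  top := mk m ⊤
  bot := mk m ⊥
  le := Quotient.lift₂ (fun s t => (s : Set X) ≤ᵐ[m] (t : Set X)) fun _ _ _ _ h h' =>
    propext ⟨fun hl => (h.symm.le.trans hl).trans h'.le,
      fun hl => (h.le.trans hl).trans h'.symm.le⟩
  le_refl a := Quotient.inductionOn a fun _ => Filter.EventuallyLE.rfl
  le_trans a b c := Quotient.inductionOn₃ a b c fun _ _ _ h h' => Filter.EventuallyLE.trans h h'
  le_antisymm a b := Quotient.inductionOn₂ a b fun _ _ h h' =>
    Quotient.sound (Filter.EventuallyLE.antisymm h h')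
  le_sup_left a b := Quotient.inductionOn₂ a b fun _ _ => Filter.Eventually.of_forall
    fun _ => Or.inl
  le_sup_right a b := Quotient.inductionOn₂ a b fun _ _ => Filter.Eventually.of_forall
    fun _ => Or.inr
  sup_le a b c := Quotient.inductionOn₃ a b c fun _ _ _ h h' => by
    filter_upwards [h, h'] with x hx hx' using fun hs => hs.elim hx hx'
  inf_le_left a b := Quotient.inductionOn₂ a b fun _ _ => Filter.Eventually.of_forall
    fun _ => And.left
  inf_le_right a b := Quotient.inductionOn₂ a b fun _ _ => Filter.Eventually.of_forall
    fun _ => And.right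
  le_inf a b c := Quotient.inductionOn₃ a b c fun _ _ _ h h' => by
    filter_upwards [h, h'] with x hx hx' using fun hs => ⟨hx hs, hx' hs⟩
  le_sup_inf a b c := Quotient.inductionOn₃ a b c fun _ _ _ => Filter.Eventually.of_forall
    fun _ h => h.1.elim Or.inl fun hb => h.2.elim Or.inl fun hc => Or.inr ⟨hb, hc⟩
  inf_compl_le_bot a := Quotient.inductionOn a fun _ => Filter.Eventually.of_forall
    fun _ h => h.2 h.1
  top_le_sup_compl a := Quotient.inductionOn a fun _ => Filter.Eventually.of_forall
    fun _ _ => Classical.em _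
  le_top a := Quotient.inductionOn a fun _ => Filter.Eventually.of_forall fun _ _ => trivial
  bot_le a := Quotient.inductionOn a fun _ => Filter.Eventually.of_forall fun _ h => h.elim
  sdiff_eq _ _ := rfl
  himp_eq _ _ := rfl

/-- The measure, as a real-valued function on the measure algebra. -/
noncomputable def measure : MeasureAlgebra m → ℝ :=
  Quotient.lift (fun s => m.real (s : Set X)) fun _ _ h => measureReal_congr h

end MeasureAlgebra

/-! ### The algebras `𝕄_κ` -/

/-- The cube `{0,1}^ι` as a compact group: the power of the discrete group `ℤ/2`. -/
def CantorCube (ι : Type u) : Type u := ι → ZMod 2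

namespace CantorCube

variable (ι : Type u)

instance : AddCommGroup (CantorCube ι) := inferInstanceAs (AddCommGroup (ι → ZMod 2))

instance : TopologicalSpace (CantorCube ι) := inferInstanceAs (TopologicalSpace (ι → ZMod 2))

instance : IsTopologicalAddGroup (CantorCube ι) :=
  inferInstanceAs (IsTopologicalAddGroup (ι → ZMod 2))

instance : CompactSpace (CantorCube ι) := inferInstanceAs (CompactSpace (ι → ZMod 2))

/-- The full Borel σ-algebra (for uncountable `ι` it is larger than the product σ-algebra). -/
instance : MeasurableSpace (CantorCube ι) := borel _

instance : BorelSpace (CantorCube ι) := ⟨rfl⟩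

instance : Nonempty (CantorCube ι) := ⟨0⟩

/-- The standard product measure on the Borel sets of `{0,1}^ι`, that is, the Haar probability
measure. -/
noncomputable def haar : Measure (CantorCube ι) :=
  Measure.addHaarMeasure (⊤ : TopologicalSpace.PositiveCompacts (CantorCube ι))

end CantorCube

/-- The algebra `𝕄_κ = Bor({0,1}^κ)/{λ_κ = 0}`, for `κ` the cardinality of `ι`. -/
abbrev RandomAlgebra (ι : Type u) : Type u := MeasureAlgebra (CantorCube.haar ι)

/-- A (finitely additive) measure `m` on a Boolean algebra is separable if the pseudometric
`d(a, b) = m (a ∆ b)` has a countable dense set. -/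
def IsSeparableMeasure {A : Type u} [BooleanAlgebra A] (m : A → ℝ) : Prop :=
  ∃ D : Set A, D.Countable ∧ ∀ a : A, ∀ ε : ℝ, 0 < ε → ∃ d ∈ D, m (a ∆ d) < ε

/-- A subalgebra is regular if its existing suprema are suprema in the big algebra; equivalently,
the trace on it of any generic filter of the big algebra is a generic filter. -/
def IsRegularSubalgebra {B : Type u} [BooleanAlgebra B] (C : BooleanSubalgebra B) : Prop :=
  ∀ (S : Set C) (x : C), IsLUB S x → IsLUB ((fun c : C => (c : B)) '' S) (x : B)

/-! ### Names and forcing -/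

/-- `B`-names: sets of pairs (name, element of `B`), built recursively. -/
inductive BName (B : Type v) : Type (max (u + 1) v)
  | mk (ι : Type u) (elem : ι → BName B) (val : ι → B) : BName B

namespace BName

/-- The image of a name under a map of algebras, applied hereditarily. -/
def map {B : Type v} {C : Type w} (e : B → C) : BName.{u} B → BName.{u} C
  | mk ι x b => mk ι (fun i => map e (x i)) (fun i => e (b i))

/-- A name is a name over `S` if all elements of the algebra hereditarily occurring in it
belong to `S`. -/
def IsNameOver {B : Type v} (S : Set B) : BName.{u} B → Prop
  | mk ι x b => ∀ i : ι, b i ∈ S ∧ IsNameOver S (x i)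

variable {B : Type v} [BooleanAlgebra B]

/-- The canonical name of a set of the ground model. -/
def check : PSet.{u} → BName.{u} B
  | PSet.mk ι x => mk ι (fun i => check (x i)) (fun _ => ⊤)

/-- The forcing relation `p ⊩ σ = τ` (conditions are the non-zero elements of `B`): every element
of `σ` is, densely below `p`, forced to be equal to an element of `τ`, and vice versa. -/
def ForcesEq : BName.{u} B → BName.{u} B → B → Prop
  | mk ι x b, mk κ y c => fun p =>
    (∀ i : ι, ∀ q : B, q ≤ p → q ≠ ⊥ → q ≤ b i →
      ∃ r : B, r ≤ q ∧ r ≠ ⊥ ∧ ∃ j : κ, r ≤ c j ∧ ForcesEq (x i) (y j) r) ∧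
    (∀ j : κ, ∀ q : B, q ≤ p → q ≠ ⊥ → q ≤ c j →
      ∃ r : B, r ≤ q ∧ r ≠ ⊥ ∧ ∃ i : ι, r ≤ b i ∧ ForcesEq (x i) (y j) r)

/-- The forcing relation `p ⊩ σ ∈ τ`. -/
def ForcesMem (σ : BName.{u} B) : BName.{u} B → B → Prop
  | mk κ y c => fun p =>
    ∀ q : B, q ≤ p → q ≠ ⊥ →
      ∃ r : B, r ≤ q ∧ r ≠ ⊥ ∧ ∃ j : κ, r ≤ c j ∧ ForcesEq σ (y j) r

end BName

section Ultrafilters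

variable {A : Type u} [BooleanAlgebra A] {B : Type v} [BooleanAlgebra B]

/-- `code` represents the elements of the type `A` by pairwise different sets of the universe. -/
def IsCoding {A : Type u} (code : A → PSet.{u}) : Prop :=
  ∀ a a' : A, (code a).Equiv (code a') → a = a'

/-- The name `{⟨a, φ(a)⟩ : a ∈ A}` given by a homomorphism `φ`. -/
def dotName (code : A → PSet.{u}) (φ : BoundedLatticeHom A B) : BName.{u} B :=
  BName.mk A (fun a => BName.check (code a)) (fun a => φ a)

/-- `1 ⊩ σ is an ultrafilter on the Boolean algebra A` (of the ground model). -/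
structure ForcesUltrafilter (code : A → PSet.{u}) (σ : BName.{u} B) : Prop where
  subset : ∀ (τ : BName.{u} B) (p : B), τ.ForcesMem σ p →
    τ.ForcesMem (BName.check (PSet.mk A code)) p
  top_mem : (BName.check (code ⊤)).ForcesMem σ ⊤
  bot_notMem : ∀ p : B, p ≠ ⊥ → ¬ (BName.check (code ⊥)).ForcesMem σ p
  mono : ∀ (a b : A) (p : B), a ≤ b → (BName.check (code a)).ForcesMem σ p →
    (BName.check (code b)).ForcesMem σ p
  inf : ∀ (a b : A) (p : B), (BName.check (code a)).ForcesMem σ p →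
    (BName.check (code b)).ForcesMem σ p → (BName.check (code (a ⊓ b))).ForcesMem σ p
  em : ∀ (a : A) (p : B), p ≠ ⊥ → ∃ q : B, q ≤ p ∧ q ≠ ⊥ ∧
    ((BName.check (code a)).ForcesMem σ q ∨ (BName.check (code aᶜ)).ForcesMem σ q)

end Ultrafilters

/-! Separability gives a countable `D` such that every `φ a` is a limit in measure of elements `φ
d`, `d ∈ D`. Representatives of the `φ d`, together with countably many coordinate sets, define a
measurable map from the cube into a standard Borel space. The coordinates make its distribution
diffuse, so the distribution function turns it into a measure preserving `θ` onto Lebesgue measure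
on the unit interval. `M'` is the image of the interval's measure algebra under `θ⁻¹`. `M'` is
closed under limits in measure by Borel–Cantelli, so it contains `φ[A]`. It is regular because the
pullback has a right adjoint, obtained from Radon–Nikodym. It is isomorphic to the random algebra
over `ℕ` because the same construction on that cube, started from its coordinates, gives a
surjective pullback. The name `σ` is then `dotName` of `f⁻¹ ∘ φ`. -/

namespace BName

/-! ### Names and the forcing relation -/

section Names

variable {B : Type v} {C : Type w}

theorem map_check [BooleanAlgebra B] [BooleanAlgebra C] {e : B → C} (he : e ⊤ = ⊤) :
    ∀ x : PSet.{u}, (check x : BName.{u} B).map e = check x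
  | PSet.mk _ x => by
    simp only [check, map, he, fun i => map_check he (x i)]

theorem isNameOver_check [BooleanAlgebra B] {S : Set B} (hS : ⊤ ∈ S) :
    ∀ x : PSet.{u}, (check x : BName.{u} B).IsNameOver S
  | PSet.mk _ x => by
    simp only [check, IsNameOver]
    exact fun i => ⟨hS, isNameOver_check hS (x i)⟩

variable [BooleanAlgebra B]

theorem ForcesEq.refl : ∀ (σ : BName.{u} B) (p : B), σ.ForcesEq σ p
  | mk _ x _ => fun _ => by
    simp only [ForcesEq]
    exact ⟨fun i q _ hq hi => ⟨q, le_rfl, hq, i, hi, ForcesEq.refl (x i) q⟩,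
      fun i q _ hq hi => ⟨q, le_rfl, hq, i, hi, ForcesEq.refl (x i) q⟩⟩

/-- If some condition forces two ground model sets to be equal, they are equal. -/
theorem ForcesEq.equiv_of_check : ∀ (x y : PSet.{u}) (p : B), p ≠ ⊥ →
    (check x : BName.{u} B).ForcesEq (check y) p → x.Equiv y
  | PSet.mk _ x, PSet.mk _ y, p, hp, h => by
    simp only [check, ForcesEq] at h
    refine ⟨fun i => ?_, fun j => ?_⟩
    · obtain ⟨r, _, hr, j, _, hj⟩ := h.1 i p le_rfl hp le_top
      exact ⟨j, ForcesEq.equiv_of_check (x i) (y j) r hr hj⟩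
    · obtain ⟨r, _, hr, i, _, hi⟩ := h.2 j p le_rfl hp le_top
      exact ⟨i, ForcesEq.equiv_of_check (x i) (y j) r hr hi⟩

end Names

end BName

section DotName

variable {A : Type u} [BooleanAlgebra A] {B : Type v} [BooleanAlgebra B]

/-- If `p \ φ a` is non-zero, some non-zero `r` below it lies under a `φ j` and forces the names of
`a` and `j` equal. Coding gives `a = j`, a contradiction. Forcing statements about `dotName` thereby
become Boolean inequalities. -/
theorem forcesMem_dotName_iff {code : A → PSet.{u}} (hcode : IsCoding code)
    (φ : BoundedLatticeHom A B) (a : A) (p : B) :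
    (BName.check (code a)).ForcesMem (dotName code φ) p ↔ p ≤ φ a := by
  simp only [dotName, BName.ForcesMem]
  refine ⟨fun h => ?_, fun h q hq hq0 =>
    ⟨q, le_rfl, hq0, a, hq.trans h, BName.ForcesEq.refl _ _⟩⟩
  by_contra hp
  obtain ⟨r, hr, hr0, j, hj, he⟩ := h (p \ φ a) sdiff_le (fun h0 => hp (sdiff_eq_bot_iff.1 h0))
  obtain rfl := hcode _ _ (BName.ForcesEq.equiv_of_check _ _ _ hr0 he)
  exact hr0 (le_bot_iff.1 (disjoint_sdiff_self_left hr hj))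

theorem forcesUltrafilter_dotName {code : A → PSet.{u}} (hcode : IsCoding code)
    (φ : BoundedLatticeHom A B) : ForcesUltrafilter code (dotName code φ) where
  subset τ p h := by
    simp only [dotName, BName.check, BName.ForcesMem] at h ⊢
    intro q hq hq0
    obtain ⟨r, hr, hr0, j, -, hj⟩ := h q hq hq0
    exact ⟨r, hr, hr0, j, le_top, hj⟩
  top_mem := by simp [forcesMem_dotName_iff hcode]
  bot_notMem p hp := by simpa [forcesMem_dotName_iff hcode] using hp
  mono a b p hab := by
    simp only [forcesMem_dotName_iff hcode]
    exact fun h => h.trans (OrderHomClass.mono φ hab)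
  inf a b p := by
    simp only [forcesMem_dotName_iff hcode, map_inf]
    exact le_inf
  em a p hp := by
    simp only [forcesMem_dotName_iff hcode, map_compl']
    by_cases h : p ⊓ φ a = ⊥
    · exact ⟨p, le_rfl, hp, Or.inr (disjoint_iff.2 h).le_compl_right⟩
    · exact ⟨p ⊓ φ a, inf_le_left, h, Or.inl inf_le_right⟩

theorem isNameOver_dotName {code : A → PSet.{u}} {φ : BoundedLatticeHom A B} {S : Set B}
    (htop : ⊤ ∈ S) (hS : ∀ a, φ a ∈ S) : (dotName code φ).IsNameOver S := by
  simp only [dotName, BName.IsNameOver]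
  exact fun a => ⟨hS a, BName.isNameOver_check htop _⟩

theorem map_dotName {C : Type w} [BooleanAlgebra C] (code : A → PSet.{u})
    {φ : BoundedLatticeHom A B} {ψ : BoundedLatticeHom A C} {e : B → C} (htop : e ⊤ = ⊤)
    (he : ∀ a, e (φ a) = ψ a) : (dotName code φ).map e = dotName code ψ := by
  simp only [dotName, BName.map, BName.map_check htop, he]

end DotName

/-! ### Measure algebras and measure preserving maps -/

namespace MeasureAlgebra

variable {X : Type u} [MeasurableSpace X] {m : Measure X}
  {Y : Type v} [MeasurableSpace Y] {n : Measure Y} {θ : X → Y}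

theorem mk_surjective : Function.Surjective (mk m) := Quotient.mk_surjective

theorem mk_le_mk {s t : Subtype (MeasurableSet : Set X → Prop)} :
    mk m s ≤ mk m t ↔ (s : Set X) ≤ᵐ[m] (t : Set X) := Iff.rfl

theorem mk_eq_mk {s t : Subtype (MeasurableSet : Set X → Prop)} :
    mk m s = mk m t ↔ (s : Set X) =ᵐ[m] (t : Set X) :=
  ⟨fun h => Quotient.exact h, fun h => Quotient.sound h⟩

/-- The homomorphism of measure algebras induced by a measure preserving map. -/
def pullback (hθ : MeasurePreserving θ m n) :
    BoundedLatticeHom (MeasureAlgebra n) (MeasureAlgebra m) where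
  toFun := Quotient.map (fun s => ⟨θ ⁻¹' s, hθ.measurable s.2⟩)
    fun _ _ h => hθ.quasiMeasurePreserving.preimage_ae_eq h
  map_sup' a b := Quotient.inductionOn₂ a b fun _ _ => rfl
  map_inf' a b := Quotient.inductionOn₂ a b fun _ _ => rfl
  map_top' := rfl
  map_bot' := rfl

theorem pullback_mk (hθ : MeasurePreserving θ m n) (s : Subtype (MeasurableSet : Set Y → Prop)) :
    pullback hθ (mk n s) = mk m ⟨θ ⁻¹' s, hθ.measurable s.2⟩ := rfl

theorem pullback_le_pullback_iff (hθ : MeasurePreserving θ m n) {a b : MeasureAlgebra n} :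
    pullback hθ a ≤ pullback hθ b ↔ a ≤ b := by
  obtain ⟨s, rfl⟩ := mk_surjective a
  obtain ⟨t, rfl⟩ := mk_surjective b
  rw [pullback_mk, pullback_mk, mk_le_mk, mk_le_mk, ae_le_set, ae_le_set, ← Set.preimage_sdiff,
    hθ.measure_preimage (s.2.diff t.2).nullMeasurableSet]

/-- The map induced by a measure preserving map of finite measure spaces has a right adjoint. -/
theorem exists_pullback_le_iff [IsFiniteMeasure m] [IsFiniteMeasure n]
    (hθ : MeasurePreserving θ m n) (y : MeasureAlgebra m) :
    ∃ b : MeasureAlgebra n, ∀ a, pullback hθ a ≤ y ↔ a ≤ b := by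
  obtain ⟨y, rfl⟩ := mk_surjective y
  -- `θ⁻¹ s ≤ y` means `ν s = 0`, that is, the density of `ν` vanishes almost everywhere on `s`. So
  -- the adjoint sends `y` to the zero set of that density.
  let ν : Measure Y := (m.restrict (y : Set X)ᶜ).map θ
  have hν : ν ≪ n := by
    rw [← hθ.map_eq]
    exact Measure.restrict_le_self.absolutelyContinuous.map hθ.measurable
  refine ⟨mk n ⟨ν.rnDeriv n ⁻¹' {0}, Measure.measurable_rnDeriv ν n (measurableSet_singleton 0)⟩,
    fun a => ?_⟩
  obtain ⟨s, rfl⟩ := mk_surjective a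
  have h1 : ν s = m (θ ⁻¹' s \ y) := by
    rw [Measure.map_apply hθ.measurable s.2, Measure.restrict_apply (hθ.measurable s.2),
      Set.sdiff_eq]
  have h2 : ν s = n.withDensity (ν.rnDeriv n) s := by rw [Measure.withDensity_rnDeriv_eq _ _ hν]
  rw [pullback_mk, mk_le_mk, mk_le_mk, ae_le_set, ae_le_set, ← h1, h2,
    withDensity_apply_eq_zero (Measure.measurable_rnDeriv ν n)]
  have : {x | ν.rnDeriv n x ≠ 0} ∩ (s : Set Y) = (s : Set Y) \ ν.rnDeriv n ⁻¹' {0} := by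
    ext x; simp [and_comm]
  rw [this]

/-- A map with a right adjoint preserves all existing suprema. -/
theorem isRegularSubalgebra_map_pullback [IsFiniteMeasure m] [IsFiniteMeasure n]
    (hθ : MeasurePreserving θ m n) :
    IsRegularSubalgebra ((⊤ : BooleanSubalgebra (MeasureAlgebra n)).map (pullback hθ)) := by
  rintro S x ⟨hx, hx'⟩
  refine ⟨?_, fun y hy => ?_⟩
  · rintro _ ⟨c, hc, rfl⟩
    exact hx hc
  · obtain ⟨b, hb⟩ := exists_pullback_le_iff hθ y
    refine le_trans (hx' (a := ⟨pullback hθ b, b, trivial, rfl⟩) ?_) ((hb b).2 le_rfl)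
    rintro ⟨_, a, ha, rfl⟩ hc
    exact (pullback_le_pullback_iff hθ).2 ((hb a).1 (hy ⟨_, hc, rfl⟩))

/-- The sets which are almost everywhere equal to the preimage of a measurable set. -/
@[reducible]
def aePreimage (m : Measure X) (θ : X → Y) : MeasurableSpace X where
  MeasurableSet' s := ∃ t, MeasurableSet t ∧ s =ᵐ[m] θ ⁻¹' t
  measurableSet_empty := ⟨∅, .empty, Filter.EventuallyEq.rfl⟩
  measurableSet_compl := fun _ ⟨t, ht, h⟩ => ⟨tᶜ, ht.compl, h.compl⟩
  measurableSet_iUnion f hf := by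
    choose t ht h using hf
    refine ⟨⋃ i, t i, .iUnion ht, ?_⟩
    rw [Set.preimage_iUnion]
    exact Filter.EventuallyEq.countable_iUnion h

theorem measurableSet_aePreimage_congr {s s' : Set X} (h : s =ᵐ[m] s')
    (hs : MeasurableSet[aePreimage m θ] s) : MeasurableSet[aePreimage m θ] s' :=
  let ⟨t, ht, h'⟩ := hs
  ⟨t, ht, h.symm.trans h'⟩

theorem mk_mem_map_pullback (hθ : MeasurePreserving θ m n)
    (s : Subtype (MeasurableSet : Set X → Prop)) :
    mk m s ∈ (⊤ : BooleanSubalgebra (MeasureAlgebra n)).map (pullback hθ) ↔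
      MeasurableSet[aePreimage m θ] (s : Set X) := by
  constructor
  · rintro ⟨a, -, ha⟩
    obtain ⟨t, rfl⟩ := mk_surjective a
    exact ⟨t, t.2, (mk_eq_mk.1 ha).symm⟩
  · rintro ⟨t, ht, h⟩
    exact ⟨mk n ⟨t, ht⟩, trivial, (mk_eq_mk.2 h).symm⟩

theorem measure_symmDiff_mk (s t : Subtype (MeasurableSet : Set X → Prop)) :
    (mk m s ∆ mk m t).measure = m.real ((s : Set X) ∆ t) := rfl

/-- A set which can be approximated in measure by members of `aePreimage m θ` is a member. -/
theorem measurableSet_aePreimage_of_approx [IsFiniteMeasure m] {s : Set X}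
    (h : ∀ ε : ℝ, 0 < ε → ∃ t, MeasurableSet[aePreimage m θ] t ∧ m.real (s ∆ t) < ε) :
    MeasurableSet[aePreimage m θ] s := by
  -- Errors `2⁻ᵏ` are summable, so by Borel–Cantelli almost every point lies in finitely many `s ∆ t
  -- k`, and `s` is almost everywhere the limsup of the `t k`.
  choose t ht hst using fun k : ℕ => h ((1 / 2) ^ k) (by positivity)
  have hsum : ∑' k, m (s ∆ t k) ≠ ⊤ := by
    refine ne_top_of_le_ne_top (b := ∑' k : ℕ, ENNReal.ofReal ((1 / 2) ^ k)) ?_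
      (ENNReal.tsum_le_tsum fun k => ?_)
    · exact summable_geometric_two.tsum_ofReal_ne_top
    · rw [← ofReal_measureReal]
      exact ENNReal.ofReal_le_ofReal (hst k).le
  refine measurableSet_aePreimage_congr (s := Filter.limsup t Filter.atTop) ?_
    (@MeasurableSet.measurableSet_limsup _ (aePreimage m θ) _ ht)
  filter_upwards [ae_eventually_notMem hsum] with x hx
  obtain ⟨N, hN⟩ := Filter.eventually_atTop.1 hx
  have hN' : ∀ k ≥ N, (x ∈ t k ↔ x ∈ s) := fun k hk => by
    have := hN k hk
    simp only [Set.mem_symmDiff] at this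
    tauto
  refine propext ?_
  change x ∈ Filter.limsup t Filter.atTop ↔ x ∈ s
  rw [Filter.limsup_eq_iInf_iSup_of_nat]
  simp only [Set.iInf_eq_iInter, Set.iSup_eq_iUnion, Set.mem_iInter, Set.mem_iUnion]
  refine ⟨fun h => ?_, fun h k => ⟨max k N, le_max_left _ _, (hN' _ (le_max_right _ _)).2 h⟩⟩
  obtain ⟨k, hk, hx⟩ := h N
  exact (hN' k hk).1 hx

end MeasureAlgebra

/-! ### Reduction of diffuse distributions to the uniform one -/

section Uniformize

open ProbabilityTheory Filter Topology

theorem continuous_cdf (μ : Measure ℝ) [IsProbabilityMeasure μ] [NullSingletonClass μ] :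
    Continuous (cdf μ) := by
  refine continuous_iff_continuousAt.2 fun x => ?_
  have h : μ {x} = 0 := measure_singleton x
  rw [← measure_cdf μ, StieltjesFunction.measure_singleton, ENNReal.ofReal_eq_zero] at h
  have h1 := (monotone_cdf μ).leftLim_le (le_refl x)
  have h2 : Function.leftLim (cdf μ) x = cdf μ x := le_antisymm h1 (by linarith)
  rw [(monotone_cdf μ).continuousAt_iff_leftLim_eq_rightLim, h2,
    ((cdf μ).right_continuous x).rightLim_eq]

/-- The probability integral transform. -/
theorem measurePreserving_cdf (μ : Measure ℝ) [IsProbabilityMeasure μ] [NullSingletonClass μ] :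
    MeasurePreserving (cdf μ) μ (volume.restrict (Set.Icc 0 1)) := by
  have hm := (continuous_cdf μ).measurable
  refine ⟨hm, ?_⟩
  have := Measure.isProbabilityMeasure_map (μ := μ) hm.aemeasurable
  refine Measure.ext_of_Iic _ _ fun s => ?_
  rw [Measure.map_apply hm measurableSet_Iic, Measure.restrict_apply measurableSet_Iic]
  rcases lt_or_ge s 0 with hs | hs
  · have h1 : cdf μ ⁻¹' Set.Iic s = ∅ := by
      ext x
      simpa using hs.trans_le (cdf_nonneg μ x)
    have h2 : Set.Iic s ∩ Set.Icc (0 : ℝ) 1 = ∅ := by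
      ext x
      simp only [Set.mem_inter_iff, Set.mem_Iic, Set.mem_Icc, Set.mem_empty_iff_false,
        iff_false]
      intro h
      linarith [h.1, h.2.1]
    simp [h1, h2]
  rcases le_or_gt 1 s with hs1 | hs1
  · have h1 : cdf μ ⁻¹' Set.Iic s = Set.univ := by
      ext x
      simpa using (cdf_le_one μ x).trans hs1
    have h2 : Set.Iic s ∩ Set.Icc (0 : ℝ) 1 = Set.Icc 0 1 :=
      Set.inter_eq_right.2 fun x hx => hx.2.trans hs1
    simp [h1, h2]
  have h2 : Set.Iic s ∩ Set.Icc (0 : ℝ) 1 = Set.Icc 0 s := by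
    ext x
    simp only [Set.mem_inter_iff, Set.mem_Iic, Set.mem_Icc]
    exact ⟨fun h => ⟨h.2.1, h.1⟩, fun h => ⟨h.2, h.1, h.2.trans hs1.le⟩⟩
  rw [h2, Real.volume_Icc, sub_zero]
  rcases Set.eq_empty_or_nonempty (cdf μ ⁻¹' Set.Iic s) with he | hne
  · have : s ≤ 0 := ge_of_tendsto' (tendsto_cdf_atBot μ) fun x => by
      by_contra hx
      exact (Set.eq_empty_iff_forall_notMem.1 he x) (not_le.1 hx).le
    simp [he, ENNReal.ofReal_of_nonpos this]
  -- Since `s < 1`, the sublevel set is bounded above. By continuity it is a half-line `Iic t` with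
  -- `cdf μ t = s`.
  · obtain ⟨z, hz⟩ := ((tendsto_cdf_atTop μ).eventually_const_lt hs1).exists
    have hbdd : BddAbove (cdf μ ⁻¹' Set.Iic s) :=
      ⟨z, fun x hx => (monotone_cdf μ).reflect_lt (lt_of_le_of_lt hx hz) |>.le⟩
    have hcl : IsClosed (cdf μ ⁻¹' Set.Iic s) := isClosed_Iic.preimage (continuous_cdf μ)
    have ht := hcl.csSup_mem hne hbdd
    set t := sSup (cdf μ ⁻¹' Set.Iic s)
    have heq : cdf μ ⁻¹' Set.Iic s = Set.Iic t := by
      ext x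
      exact ⟨fun hx => le_csSup hbdd hx, fun hx => (monotone_cdf μ hx).trans ht⟩
    have hst : s ≤ cdf μ t := by
      refine ge_of_tendsto (((continuous_cdf μ).tendsto t).mono_left nhdsWithin_le_nhds)
        (eventually_mem_nhdsWithin.mono fun x (hx : x ∈ Set.Ioi t) => ?_)
      by_contra h
      exact not_le.2 hx (le_csSup hbdd (not_le.1 h).le)
    rw [heq, ← ofReal_cdf, le_antisymm ht hst]

/-- The left side is contained in the right, and both have measure `cdf μ t`. -/
theorem Iic_ae_eq_preimage_cdf (μ : Measure ℝ) [IsProbabilityMeasure μ] [NullSingletonClass μ] (t : ℝ) :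
    Set.Iic t =ᵐ[μ] cdf μ ⁻¹' Set.Iic (cdf μ t) := by
  refine ae_eq_of_subset_of_measure_ge (fun x hx => monotone_cdf μ hx) ?_
    measurableSet_Iic.nullMeasurableSet (measure_ne_top _ _)
  rw [(measurePreserving_cdf μ).measure_preimage measurableSet_Iic.nullMeasurableSet,
    Measure.restrict_apply measurableSet_Iic, ← ofReal_cdf]
  refine (measure_mono (t := Set.Icc 0 (cdf μ t)) fun x hx => ⟨hx.2.1, hx.1⟩).trans ?_
  rw [Real.volume_Icc, sub_zero]

/-- Any measurable map from a probability space to a standard Borel space with diffuse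
distribution factors almost everywhere through a uniformly distributed one. -/
theorem exists_measurePreserving_uniform {X : Type u} [MeasurableSpace X] (m : Measure X)
    [IsProbabilityMeasure m] {Y : Type v} [MeasurableSpace Y] [StandardBorelSpace Y] {g : X → Y}
    (hg : Measurable g) (hdiffuse : ∀ y, m (g ⁻¹' {y}) = 0) :
    ∃ θ : X → ℝ, MeasurePreserving θ m (volume.restrict (Set.Icc 0 1)) ∧
      MeasurableSpace.comap g inferInstance ≤ MeasureAlgebra.aePreimage m θ := by
  have hemb := measurableEmbedding_embeddingReal Y
  have hm : Measurable (embeddingReal Y ∘ g) := hemb.measurable.comp hg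
  let ν := m.map (embeddingReal Y ∘ g)
  have hν : MeasurePreserving (embeddingReal Y ∘ g) m ν := ⟨hm, rfl⟩
  have : IsProbabilityMeasure ν := Measure.isProbabilityMeasure_map hm.aemeasurable
  have : NullSingletonClass ν := ⟨fun t => by
    rw [Measure.map_apply hm (measurableSet_singleton t)]
    by_cases ht : ∃ y, embeddingReal Y y = t
    · obtain ⟨y, rfl⟩ := ht
      refine measure_mono_null (fun x hx => ?_) (hdiffuse y)
      exact hemb.injective hx
    · convert measure_empty (μ := m)
      ext x
      simpa using fun h => ht ⟨_, h⟩⟩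
  refine ⟨cdf ν ∘ (embeddingReal Y ∘ g), (measurePreserving_cdf ν).comp hν, ?_⟩
  have key : borel ℝ ≤ MeasurableSpace.map (embeddingReal Y ∘ g)
      (MeasureAlgebra.aePreimage m (cdf ν ∘ (embeddingReal Y ∘ g))) := by
    rw [borel_eq_generateFrom_Iic]
    refine MeasurableSpace.generateFrom_le ?_
    rintro _ ⟨t, rfl⟩
    exact ⟨Set.Iic (cdf ν t), measurableSet_Iic,
      hν.quasiMeasurePreserving.preimage_ae_eq (Iic_ae_eq_preimage_cdf ν t)⟩
  rintro _ ⟨s, hs, rfl⟩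
  have h := key _ ((BorelSpace.measurable_eq (α := ℝ)) ▸ hemb.measurableSet_image.2 hs)
  change MeasurableSet[MeasureAlgebra.aePreimage m _] (embeddingReal Y ∘ g ⁻¹' (embeddingReal Y '' s)) at h
  rwa [Set.preimage_comp, hemb.injective.preimage_image] at h

end Uniformize

/-! ### The cube and its Haar measure -/

namespace CantorCube

variable {κ : Type u}

instance : IsProbabilityMeasure (haar κ) := ⟨Measure.addHaarMeasure_self⟩

instance : (haar κ).IsAddLeftInvariant :=
  inferInstanceAs (Measure.addHaarMeasure _).IsAddLeftInvariant

theorem isOpen_preimage_eval (i : κ) (s : Set (ZMod 2)) :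
    IsOpen {x : CantorCube κ | x i ∈ s} :=
  (isOpen_discrete s).preimage (continuous_apply i)

/-- Prescribing infinitely many coordinates gives a null set. -/
theorem haar_setOf_forall_eq {e : ℕ → κ} (he : Function.Injective e) (c : ℕ → ZMod 2) :
    haar κ {x | ∀ n, x (e n) = c n} = 0 := by
  classical
  set K : Set (CantorCube κ) := {x | ∀ n, x (e n) = c n} with hK_def
  have hK : MeasurableSet K := by
    rw [hK_def, Set.ofPred_forall]
    exact .iInter fun n => (isOpen_preimage_eval (e n) {c n}).measurableSet
  -- Translating by `v k` flips coordinate `e k`. The translates of `K` are pairwise disjoint and of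
  -- equal measure, so finiteness of the measure forces `K` to be null.
  let v : ℕ → CantorCube κ := fun n => (Pi.single (e n) 1 : κ → ZMod 2)
  have hv : ∀ k n x, (v k + x : CantorCube κ) (e n) = (if n = k then 1 else 0) + x (e n) := by
    intro k n x
    change (Pi.single (e k) 1 : κ → ZMod 2) (e n) + x (e n) = _
    simp [Pi.single_apply, he.eq_iff]
  have hmeas : ∀ k, haar κ ((v k + ·) ⁻¹' K) = haar κ K := fun k =>
    measure_preimage_add _ _ _
  have hdisj : Pairwise (Function.onFun Disjoint fun k => (v k + ·) ⁻¹' K) := by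
    intro k l hkl
    refine Set.disjoint_left.2 fun x hx hx' => ?_
    have h1 : (v k + x : CantorCube κ) (e k) = c k := hx k
    have h2 : (v l + x : CantorCube κ) (e k) = c k := hx' k
    rw [hv] at h1 h2
    rw [if_pos rfl] at h1
    rw [if_neg hkl, zero_add] at h2
    rw [h2] at h1
    simp at h1
  by_contra h0
  have h := measure_iUnion (μ := haar κ) hdisj fun k =>
    (continuous_const.add continuous_id).measurable hK
  simp only [hmeas, ENNReal.tsum_const_eq_top_of_ne_zero h0] at h
  exact measure_ne_top _ _ h

/-- Countably many measurable sets are preimages, up to null sets, under a measure preserving map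
to the unit interval. -/
theorem exists_measurePreserving_uniform [Infinite κ] {ι : Type v} [Countable ι]
    (C : ι → Set (CantorCube κ)) (hC : ∀ i, MeasurableSet (C i)) :
    ∃ θ : CantorCube κ → ℝ, MeasurePreserving θ (haar κ) (volume.restrict (Set.Icc 0 1)) ∧
      ∀ i, MeasurableSet[MeasureAlgebra.aePreimage (haar κ) θ] (C i) := by
  classical
  let e := Infinite.natEmbedding κ
  -- The added coordinate sets make each fibre of `g` prescribe infinitely many coordinates, hence
  -- null.
  let D : ℕ ⊕ ι → Set (CantorCube κ) := Sum.elim (fun n => {x | x (e n) ∈ ({1} : Set (ZMod 2))}) C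
  have hD : ∀ j, MeasurableSet (D j) := by
    rintro (n | i)
    · exact (isOpen_preimage_eval _ _).measurableSet
    · exact hC i
  let g : CantorCube κ → (ℕ ⊕ ι → Bool) := fun x j => decide (x ∈ D j)
  have hpre : ∀ j, g ⁻¹' {y | y j = true} = D j := fun j => by ext x; simp [g]
  have hg : Measurable g := measurable_pi_lambda _ fun j => measurable_to_bool <| by
    convert hD j
    ext x
    simp [g]
  obtain ⟨θ, hθ, hle⟩ := _root_.exists_measurePreserving_uniform (haar κ) hg fun y => by
    refine measure_mono_null ?_ (haar_setOf_forall_eq e.injective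
      fun n => if y (Sum.inl n) = true then 1 else 0)
    intro x hx n
    obtain rfl : g x = y := hx
    simp only [g, D, Sum.elim_inl, Set.mem_ofPred_eq, Set.mem_singleton_iff]
    have hz : ∀ z : ZMod 2, z = if z = 1 then 1 else 0 := by decide
    refine (hz (x (e n))).trans (if_congr ?_ rfl rfl)
    exact (@decide_eq_true_iff _ (_)).symm
  refine ⟨θ, hθ, fun i => hle _ ⟨{y | y (Sum.inr i) = true}, ?_, hpre (Sum.inr i)⟩⟩
  exact (measurable_pi_apply (X := fun _ => Bool) (Sum.inr i)) (measurableSet_singleton true)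

/-- For countable `κ` the Borel σ-algebra is the product one, so coordinate sets generate it. -/
theorem measurableSpace_le_of_countable [Countable κ] {M : MeasurableSpace (CantorCube κ)}
    (hM : ∀ i, MeasurableSet[M] {x : CantorCube κ | x i = 1}) :
    CantorCube.instMeasurableSpace κ ≤ M := by
  change borel (κ → ZMod 2) ≤ M
  have : BorelSpace (ZMod 2) := ⟨borel_eq_top_of_discrete.symm⟩
  rw [← BorelSpace.measurable_eq (α := κ → ZMod 2)]
  refine iSup_le fun i => ?_
  refine Measurable.comap_le (m₁ := M) (@measurable_to_countable' _ _ _ _ M _ fun z => ?_)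
  have hz : ∀ z : ZMod 2, z = 1 ∨ z = 0 := by decide
  rcases hz z with rfl | rfl
  · exact hM i
  · convert (hM i).compl
    ext x
    have : ∀ z : ZMod 2, z = 0 ↔ ¬ z = 1 := by decide
    exact this _

end CantorCube

/-- The random algebra on countably many generators is isomorphic to the measure algebra of the
unit interval. -/
theorem exists_orderIso_unitInterval :
    Nonempty (RandomAlgebra ℕ ≃o MeasureAlgebra (volume.restrict (Set.Icc (0 : ℝ) 1))) := by
  obtain ⟨θ, hθ, h⟩ := CantorCube.exists_measurePreserving_uniform
    (fun i : ℕ => {x : CantorCube ℕ | x i = 1})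
    fun i => (CantorCube.isOpen_preimage_eval i {1}).measurableSet
  have hle := CantorCube.measurableSpace_le_of_countable h
  refine ⟨(RelIso.ofSurjective (OrderEmbedding.ofMapLEIff (MeasureAlgebra.pullback hθ)
    fun _ _ => MeasureAlgebra.pullback_le_pullback_iff hθ) fun y => ?_).symm⟩
  obtain ⟨s, rfl⟩ := MeasureAlgebra.mk_surjective y
  obtain ⟨a, -, ha⟩ := (MeasureAlgebra.mk_mem_map_pullback hθ s).2 (hle _ s.2)
  exact ⟨a, ha⟩

theorem mainTheorem5 {A κ : Type u} [BooleanAlgebra A] [Infinite κ]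
    (φ : BoundedLatticeHom A (RandomAlgebra κ))
    (hφ : IsSeparableMeasure (fun a : A => (φ a).measure)) :
    ∃ M' : BooleanSubalgebra (RandomAlgebra κ),
      (∀ a : A, φ a ∈ M') ∧ IsRegularSubalgebra M' ∧
      ∃ f : RandomAlgebra ℕ ≃o M',
        ∀ code : A → PSet.{u}, IsCoding code →
          (dotName code φ).IsNameOver (M' : Set (RandomAlgebra κ)) ∧
          ∃ σ : BName.{u} (RandomAlgebra ℕ), ForcesUltrafilter code σ ∧
            (σ.map (fun b => (f b : RandomAlgebra κ))).ForcesEq (dotName code φ) ⊤ := by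
  obtain ⟨D, hD, hdense⟩ := hφ
  have := hD.to_subtype
  choose s hs using fun a : A => MeasureAlgebra.mk_surjective (φ a)
  obtain ⟨θ, hθ, hθD⟩ := CantorCube.exists_measurePreserving_uniform
    (fun d : D => (s d : Set (CantorCube κ))) fun d => (s d).2
  let M' : BooleanSubalgebra (RandomAlgebra κ) :=
    (⊤ : BooleanSubalgebra (MeasureAlgebra _)).map (MeasureAlgebra.pullback hθ)
  have hmem : ∀ a, φ a ∈ M' := fun a => by
    rw [← hs a, MeasureAlgebra.mk_mem_map_pullback]
    refine MeasureAlgebra.measurableSet_aePreimage_of_approx fun ε hε => ?_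
    obtain ⟨d, hd, had⟩ := hdense a ε hε
    refine ⟨s d, hθD ⟨d, hd⟩, ?_⟩
    -- `φ` commutes with `∆`, so closeness in `A` is closeness in measure of the representatives.
    change (φ (a ∆ d)).measure < ε at had
    rwa [map_symmDiff', ← hs a, ← hs d, MeasureAlgebra.measure_symmDiff_mk] at had
  obtain ⟨e⟩ := exists_orderIso_unitInterval
  let e' : MeasureAlgebra (volume.restrict (Set.Icc (0 : ℝ) 1)) ≃o M' :=
    RelIso.ofSurjective (OrderEmbedding.ofMapLEIff
      (fun a => (⟨MeasureAlgebra.pullback hθ a, a, trivial, rfl⟩ : M'))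
      fun _ _ => MeasureAlgebra.pullback_le_pullback_iff hθ) fun ⟨_, a, _, ha⟩ =>
        ⟨a, Subtype.ext ha⟩
  let f : RandomAlgebra ℕ ≃o M' := e.trans e'
  have hftop : ((f ⊤ : M') : RandomAlgebra κ) = ⊤ := by rw [map_top]; rfl
  let toM : BoundedLatticeHom A M' :=
    { toFun := fun a => ⟨φ a, hmem a⟩
      map_sup' := fun a b => Subtype.ext (map_sup φ a b)
      map_inf' := fun a b => Subtype.ext (map_inf φ a b)
      map_top' := Subtype.ext (map_top φ)
      map_bot' := Subtype.ext (map_bot φ) }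
  let ψ : BoundedLatticeHom A (RandomAlgebra ℕ) := (f.symm : BoundedLatticeHom M' _).comp toM
  refine ⟨M', hmem, MeasureAlgebra.isRegularSubalgebra_map_pullback hθ, f, fun code hcode =>
    ⟨isNameOver_dotName M'.top_mem hmem, dotName code ψ, forcesUltrafilter_dotName hcode ψ, ?_⟩⟩
  -- Applying `f` hereditarily to `σ` gives `dotName code φ` itself, not merely a name forced equal
  -- to it.
  rw [map_dotName code (ψ := φ) hftop fun a => congrArg Subtype.val (f.apply_symm_apply (toM a))]
  exact BName.ForcesEq.refl _ _
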